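/- Let $\mathcal H,\mathcal K$ be complex Hilbert spaces. For strictly positive (positive and invertible) operators $A,B$ on a Hilbert space put $A\nabla B=\tfrac12(A+B)$ and $A\,!\,B=\big(\tfrac12(A^{-1}+B^{-1})\big)^{-1}$. An operator mean on a Hilbert space is a binary operation $\sigma$ on the set of its strictly positive bounded operators such that (i) $A\le C$ and $B\le D$ imply $A\sigma B\le C\sigma D$; (ii) $C^*(A\sigma B)C\le (C^*AC)\sigma(C^*BC)$ for every bounded operator $C$ for which $C^*AC$ and $C^*BC$ are strictly positive; (iii) $A_n\downarrow A$ and $B_n\downarrow B$ imply $A_n\sigma B_n\downarrow A\sigma B$, where $A_n\downarrow A$ means that $A_1\ge A_2\ge\cdots$ and $A_n\to A$ in the strong operator topology; (iv) $I\sigma I=I$. It lies between the harmonic and the arithmetic mean if $A\,!\,B\le A\sigma B\le A\nabla B$ for all strictly positive $A,B$. Let $\sigma$ and $\tau$ be operator means between the harmonic and the arithmetic mean, given on $\mathcal H$ and on $\mathcal K$ (no relation between the operations on the two spaces is needed; in particular they may be the same Kubo–Ando means). Let $m,M$ be real numbers with $0<m$, let $A,B$ be bounded operators on $\mathcal H$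 with $mI\le A\le MI$ and $mI\le B\le MI$, let $1<\alpha\le 2$ and $p\ge 2\alpha$ be real numbers, and let $\Phi:\mathcal B(\mathcal H)\to\mathcal B(\mathcal K)$ be a positive linear map with $\Phi(I)=I$. Put $h=M/m$, $k=\frac{(h+1)^2}{4h}$ and $$c=\frac{\big(k^{\alpha/2}(M^\alpha+m^\alpha)\big)^{2p/\alpha}}{16M^pm^p}.$$ Then $$\Phi(A\sigma B)^p\le c\,\Phi(A\tau B)^p,\qquad \Phi(A\sigma B)^p\le c\,(\Phi(A)\tau\Phi(B))^p,$$ $$(\Phi(A)\sigma\Phi(B))^p\le c\,\Phi(A\tau B)^p,\qquad (\Phi(A)\sigma\Phi(B))^p\le c\,(\Phi(A)\tau\Phi(B))^p.$$ -/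

import Mathlib

open Filter Topology

/-- `A ∇ B = (A + B) / 2`, the arithmetic mean of two operators. -/
noncomputable def arithmeticMean {H : Type*} [NormedAddCommGroup H] [InnerProductSpace ℂ H]
    (A B : H →L[ℂ] H) : H →L[ℂ] H :=
  (1 / 2 : ℝ) • A + (1 / 2 : ℝ) • B

/-- `A ! B = ((A⁻¹ + B⁻¹) / 2)⁻¹`, the harmonic mean of two operators. It is meaningful for strictly
positive (hence invertible) `A` and `B`, where `Ring.inverse` is the genuine inverse. -/
noncomputable def harmonicMean {H : Type*} [NormedAddCommGroup H] [InnerProductSpace ℂ H]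
    (A B : H →L[ℂ] H) : H →L[ℂ] H :=
  Ring.inverse ((1 / 2 : ℝ) • Ring.inverse A + (1 / 2 : ℝ) • Ring.inverse B)

/-- `A n ↓ A`: the sequence is decreasing in the Loewner order and converges to `A` in the strong
operator topology. -/
def DecreasesTo {H : Type*} [NormedAddCommGroup H] [InnerProductSpace ℂ H] [CompleteSpace H]
    (S : ℕ → H →L[ℂ] H) (A : H →L[ℂ] H) : Prop :=
  Antitone S ∧ ∀ x : H, Tendsto (fun n => S n x) atTop (𝓝 (A x))

/-- Operator means on `B(H)` in the sense of Kubo and Ando: binary operations on the set of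
strictly positive operators (`IsStrictlyPositive A` says that `A` is positive and invertible) which
are monotone, satisfy the transformer inequality, are continuous from above, and are normalized.
The operation is written as a total function on `B(H)`; its values outside the strictly
positive operators are irrelevant. -/
structure IsOperatorMean {H : Type*} [NormedAddCommGroup H] [InnerProductSpace ℂ H]
    [CompleteSpace H] (σ : (H →L[ℂ] H) → (H →L[ℂ] H) → (H →L[ℂ] H)) : Prop where
  isStrictlyPositive : ∀ A B : H →L[ℂ] H, IsStrictlyPositive A → IsStrictlyPositive B →
    IsStrictlyPositive (σ A B)
  monotone : ∀ A B C D : H →L[ℂ] H, IsStrictlyPositive A → IsStrictlyPositive B →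
    IsStrictlyPositive C → IsStrictlyPositive D → A ≤ C → B ≤ D → σ A B ≤ σ C D
  /-- `C* (A σ B) C ≤ (C* A C) σ (C* B C)` for every operator `C` for which the right-hand side is
  a mean of strictly positive operators. -/
  transformer : ∀ A B C : H →L[ℂ] H, IsStrictlyPositive A → IsStrictlyPositive B →
    IsStrictlyPositive (star C * A * C) → IsStrictlyPositive (star C * B * C) →
    star C * σ A B * C ≤ σ (star C * A * C) (star C * B * C)
  upper_continuous : ∀ (S T : ℕ → H →L[ℂ] H) (A B : H →L[ℂ] H),
    (∀ n, IsStrictlyPositive (S n)) → (∀ n, IsStrictlyPositive (T n)) →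
    IsStrictlyPositive A → IsStrictlyPositive B → DecreasesTo S A → DecreasesTo T B →
    DecreasesTo (fun n => σ (S n) (T n)) (σ A B)
  normalized : σ 1 1 = 1

/-- `σ` lies between the harmonic and the arithmetic mean: `A ! B ≤ A σ B ≤ A ∇ B` for all strictly
positive `A` and `B`. -/
def IsBetweenHarmonicArithmetic {H : Type*} [NormedAddCommGroup H] [InnerProductSpace ℂ H]
    [CompleteSpace H] (σ : (H →L[ℂ] H) → (H →L[ℂ] H) → (H →L[ℂ] H)) : Prop :=
  ∀ A B : H →L[ℂ] H, IsStrictlyPositive A → IsStrictlyPositive B →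
    harmonicMean A B ≤ σ A B ∧ σ A B ≤ arithmeticMean A B

/-- The Kantorovich constant `K(h) = (h + 1)² / (4 h)`. -/
noncomputable def kantorovich (h : ℝ) : ℝ := (h + 1) ^ 2 / (4 * h)

/-- The constant `(k ^ (α / 2) (M ^ α + m ^ α)) ^ (2 p / α) / (16 M ^ p m ^ p)` with
`k = K(M / m)`. -/
noncomputable def meanBound (m M α p : ℝ) : ℝ :=
  (kantorovich (M / m) ^ (α / 2) * (M ^ α + m ^ α)) ^ (2 * p / α) / (16 * M ^ p * m ^ p)

/-! Let X be either operator on the left and Y either one on the right. Since X ≤ Φ(A) ∇ Φ(B) and,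
by Choi's inequality, Y⁻¹ ≤ Φ(A⁻¹) ∇ Φ(B⁻¹), applying Φ to T + Mm T⁻¹ ≤ M + m for T = A, B gives X +
Mm Y⁻¹ ≤ M + m. Only this and m ≤ X ≤ M are needed (`rpow_le_meanBound_smul_rpow`).

The Bhatia–Kittaneh inequality turns such a bound on a sum into one on a product: P + a Q⁻¹ ≤ s
gives ‖P Q⁻¹‖ ≤ s² / (4a), hence a comparison of P² with Q² (`rpow_two_le_of_add_smul_inv_le`). It
is used twice. The first use gives X² ≤ k² Y², and Löwner–Heinz and inversion give Y^(-α) ≤ k^α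
X^(-α). This yields a scalar bound on a weighted sum of X^α and Y^(-α). Raising the summands to the
power p / (2α) ≥ 1 (`rpow_add_rpow_le`) bounds a sum of X^(p/2) and Y^(-p/2), and the second use
gives the result. -/

/-! ### Cauchy–Schwarz and the Bhatia–Kittaneh inequality -/

open scoped InnerProductSpace in
/-- Cauchy–Schwarz inequality for the semi-inner product of a positive operator. -/
theorem sq_re_inner_le_of_nonneg {E : Type*} [NormedAddCommGroup E] [InnerProductSpace ℂ E]
    [CompleteSpace E] {T : E →L[ℂ] E} (hT : 0 ≤ T) (u z : E) :
    (⟪T u, z⟫_ℂ).re ^ 2 ≤ (⟪T u, u⟫_ℂ).re * (⟪T z, z⟫_ℂ).re := by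
  obtain ⟨S, rfl⟩ := CStarAlgebra.nonneg_iff_eq_star_mul_self.mp hT
  have h : ∀ x y : E, ⟪(star S * S) x, y⟫_ℂ = ⟪S x, S y⟫_ℂ := fun x y => by
    simp [ContinuousLinearMap.star_eq_adjoint, ContinuousLinearMap.adjoint_inner_left]
  rw [h, h, h, inner_self_eq_norm_sq_to_K, inner_self_eq_norm_sq_to_K]
  have h1 : |(⟪S u, S z⟫_ℂ).re| ≤ ‖S u‖ * ‖S z‖ :=
    (Complex.abs_re_le_norm _).trans (norm_inner_le_norm _ _)
  have h2 := pow_le_pow_left₀ (abs_nonneg _) h1 2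
  rw [sq_abs] at h2
  have h3 : ∀ r : ℝ, ((r : ℂ) ^ 2).re = r ^ 2 := fun r => by norm_cast
  simpa [h3, mul_pow] using h2

open scoped InnerProductSpace in
theorem re_inner_le_of_le {E : Type*} [NormedAddCommGroup E] [InnerProductSpace ℂ E]
    {S T : E →L[ℂ] E} (h : S ≤ T) (x : E) : (⟪S x, x⟫_ℂ).re ≤ (⟪T x, x⟫_ℂ).re := by
  have := ((ContinuousLinearMap.le_def S T).mp h).re_inner_nonneg_left x
  simpa [inner_sub_left] using this

open scoped InnerProductSpace in
/-- The scalar inequality behind `norm_apply_apply_le`: if the sum of the rank one operators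
`a ⊗ a + b ⊗ b` is at most `s`, then `(s - |a|²) (s - |b|²) ≥ |⟨a, b⟩|²`. -/
theorem mul_le_of_rank_one_bound {V U q t s n : ℝ} (hq : 0 < q) (ht : 0 < t)
    (hV : 0 < V) (hU : 0 < U) (htU : t ^ 2 ≤ U * n) (hn : 0 ≤ n)
    (h : ∀ y₁ y₂ : ℝ, (y₁ * V + y₂ * q) ^ 2 / q + (y₁ * q + y₂ * U) ^ 2 / t ≤
      s * (y₁ ^ 2 * V + 2 * y₁ * y₂ * q + y₂ ^ 2 * U)) :
    V ≤ (s ^ 2 / 4) ^ 2 * n := by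
  -- With V = ‖v‖², U = ‖u‖², q = ⟨v, u⟩, the numbers a and b are the squared norms of v/√q and
  -- u/√t, and g is their squared inner product.
  obtain ⟨a, rfl⟩ : ∃ a, V = a * q := ⟨V / q, by field_simp⟩
  obtain ⟨b, rfl⟩ : ∃ b, U = b * t := ⟨U / t, by field_simp⟩
  obtain ⟨g, rfl⟩ : ∃ g, q = g * t := ⟨q / t, by field_simp⟩
  have hg : 0 < g := pos_of_mul_pos_left hq ht.le
  have ha : 0 < a := pos_of_mul_pos_left hV hq.le
  have hb : 0 < b := pos_of_mul_pos_left hU ht.le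
  have htn : t ≤ b * n := by nlinarith
  have hsb : g + b ^ 2 ≤ s * b := by
    have := h 0 1
    have e : (0 * (a * (g * t)) + 1 * (g * t)) ^ 2 / (g * t) + (0 * (g * t) + 1 * (b * t)) ^ 2 / t
      = t * (g + b ^ 2) := by field_simp; ring
    rw [e] at this
    nlinarith
  have hsb' : b < s := by nlinarith
  have hw : 0 < (s - b) * a + g := by nlinarith [mul_pos (sub_pos.2 hsb') ha]
  -- The vector (s - b) v + g u is proportional to (s - u ⊗ u / t)⁻¹ v, the extremal test vector for
  -- v ⊗ v / q ≤ s - u ⊗ u / t.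
  have key : (s - b) * a + g ≤ s * (s - b) := by
    have := h (s - b) g
    have e : ((s - b) * (a * (g * t)) + g * (g * t)) ^ 2 / (g * t) +
        ((s - b) * (g * t) + g * (b * t)) ^ 2 / t =
        (g * t) * (((s - b) * a + g) ^ 2 + g * s ^ 2) := by field_simp; ring
    rw [e] at this
    have e2 : s * ((s - b) ^ 2 * (a * (g * t)) + 2 * (s - b) * g * (g * t) + g ^ 2 * (b * t)) =
        (g * t) * (s * (s - b) * ((s - b) * a + g) + g * s ^ 2) := by ring
    rw [e2] at this
    have := le_of_mul_le_mul_left this hq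
    have : ((s - b) * a + g) * ((s - b) * a + g) ≤ (s * (s - b)) * ((s - b) * a + g) := by
      nlinarith
    exact le_of_mul_le_mul_right this hw
  have hgg : g ≤ (s - a) * (s - b) := by nlinarith
  have hsa : 0 < s - a := pos_of_mul_pos_left (hg.trans_le hgg) (sub_pos.2 hsb').le
  have h1 : a * (s - a) ≤ s ^ 2 / 4 := by nlinarith [sq_nonneg (s - 2 * a)]
  have h2 : b * (s - b) ≤ s ^ 2 / 4 := by nlinarith [sq_nonneg (s - 2 * b)]
  calc a * (g * t) ≤ a * (((s - a) * (s - b)) * (b * n)) := by gcongr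
    _ = (a * (s - a)) * (b * (s - b)) * n := by ring
    _ ≤ (s ^ 2 / 4) * (s ^ 2 / 4) * n := by
        have : 0 ≤ b * (s - b) := by nlinarith
        gcongr
    _ = _ := by ring

open scoped InnerProductSpace in
/-- The Bhatia–Kittaneh inequality `‖P Q‖ ≤ ‖P + Q‖² / 4` for positive operators. -/
theorem norm_apply_apply_le {E : Type*} [NormedAddCommGroup E] [InnerProductSpace ℂ E]
    [CompleteSpace E] {P Q : E →L[ℂ] E} (hP : 0 ≤ P) (hQ : 0 ≤ Q) {s : ℝ}
    (h : P + Q ≤ s • (1 : E →L[ℂ] E)) (x : E) : ‖P (Q x)‖ ≤ s ^ 2 / 4 * ‖x‖ := by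
  set u := Q x with hu
  set v := P u with hv
  by_cases hv0 : v = 0
  · rw [hv0, norm_zero]; positivity
  have hu0 : u ≠ 0 := fun h0 => hv0 (by rw [hv, h0, map_zero])
  have hVpos : 0 < ‖v‖ ^ 2 := by positivity
  have hUpos : 0 < ‖u‖ ^ 2 := by positivity
  have hre : ∀ w : E, (⟪w, w⟫_ℂ).re = ‖w‖ ^ 2 := fun w => by
    rw [inner_self_eq_norm_sq_to_K]; norm_cast
  have hq0 := re_inner_le_of_le hP u
  have ht0 := re_inner_le_of_le hQ x
  simp only [zero_apply, inner_zero_left, Complex.zero_re] at hq0 ht0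
  rw [← hv] at hq0
  rw [← hu] at ht0
  -- If ⟨P u, u⟩ vanished, Cauchy–Schwarz against P u would force P u = 0.
  have hq : 0 < (⟪v, u⟫_ℂ).re := by
    refine lt_of_le_of_ne hq0 fun h0 => ?_
    have := sq_re_inner_le_of_nonneg hP u v
    rw [← hv, ← h0, zero_mul, hre] at this
    nlinarith
  have ht : 0 < (⟪u, x⟫_ℂ).re := by
    refine lt_of_le_of_ne ht0 fun h0 => ?_
    have := sq_re_inner_le_of_nonneg hQ x u
    rw [← hu, ← h0, zero_mul, hre] at this
    nlinarith
  have hsymm : (⟪u, v⟫_ℂ).re = (⟪v, u⟫_ℂ).re := by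
    rw [← inner_conj_symm, Complex.conj_re]
  have htU : (⟪u, x⟫_ℂ).re ^ 2 ≤ ‖u‖ ^ 2 * ‖x‖ ^ 2 := by
    have h1 : |(⟪u, x⟫_ℂ).re| ≤ ‖u‖ * ‖x‖ :=
      (Complex.abs_re_le_norm _).trans (norm_inner_le_norm _ _)
    have h2 := pow_le_pow_left₀ (abs_nonneg _) h1 2
    rwa [sq_abs, mul_pow] at h2
  -- By Cauchy–Schwarz P ≥ v ⊗ v / q and Q ≥ u ⊗ u / t, so the rank one operators inherit the bound
  -- s; testing on the real span of v and u suffices.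
  have key : ‖v‖ ^ 2 ≤ (s ^ 2 / 4) ^ 2 * ‖x‖ ^ 2 := by
    refine mul_le_of_rank_one_bound hq ht hVpos hUpos htU (by positivity) fun y₁ y₂ => ?_
    set z : E := (y₁ : ℂ) • v + (y₂ : ℂ) • u with hz
    have hvz : (⟪v, z⟫_ℂ).re = y₁ * ‖v‖ ^ 2 + y₂ * (⟪v, u⟫_ℂ).re := by
      simp [hz, ← hre]
    have huz : (⟪u, z⟫_ℂ).re = y₁ * (⟪v, u⟫_ℂ).re + y₂ * ‖u‖ ^ 2 := by
      simp [hz, ← hre, hsymm]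
    have hzz : (⟪z, z⟫_ℂ).re =
        y₁ ^ 2 * ‖v‖ ^ 2 + 2 * y₁ * y₂ * (⟪v, u⟫_ℂ).re + y₂ ^ 2 * ‖u‖ ^ 2 := by
      have : (⟪z, z⟫_ℂ).re = y₁ * (⟪v, z⟫_ℂ).re + y₂ * (⟪u, z⟫_ℂ).re := by
        conv_lhs => enter [1, 2]; rw [hz]
        simp
      rw [this, hvz, huz]; ring
    have hPz := sq_re_inner_le_of_nonneg hP u z
    have hQz := sq_re_inner_le_of_nonneg hQ x z
    rw [← hv, hvz] at hPz
    rw [← hu, huz] at hQz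
    have hsum := re_inner_le_of_le h z
    have hs1 : (⟪(s • (1 : E →L[ℂ] E)) z, z⟫_ℂ).re = s * (⟪z, z⟫_ℂ).re := by
      simp [inner_smul_left_eq_smul]
    have hs2 : (⟪(P + Q) z, z⟫_ℂ).re = (⟪P z, z⟫_ℂ).re + (⟪Q z, z⟫_ℂ).re := by
      simp
    rw [hs1, hs2, hzz] at hsum
    refine le_trans (add_le_add ?_ ?_) hsum
    · rw [div_le_iff₀ hq]; linarith
    · rw [div_le_iff₀ ht]; linarith
  rw [← mul_pow] at key
  exact le_of_sq_le_sq key (by positivity)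

/-! ### Choi's inequality -/

open scoped InnerProductSpace unitInterval in
/-- A positive unital map on the commutative algebra `C(I, ℝ)` is `2`-positive on the rank one
matrix `[[f, 1], [1, f⁻¹]]`. -/
theorem two_re_inner_le_of_positive_unital {E : Type*} [NormedAddCommGroup E]
    [InnerProductSpace ℂ E] [CompleteSpace E] (Ψ : C(I, ℝ) →L[ℝ] (E →L[ℂ] E))
    (hpos : ∀ g : C(I, ℝ), 0 ≤ g → 0 ≤ Ψ g) (hone : Ψ 1 = 1) (f g : C(I, ℝ))
    (hf : ∀ t, 0 < f t) (hfg : ∀ t, f t * g t = 1) (x y : E) :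
    2 * (⟪x, y⟫_ℂ).re ≤ (⟪Ψ f x, x⟫_ℂ).re + (⟪Ψ g y, y⟫_ℂ).re := by
  -- Bernstein polynomials form a positive partition of unity, so Ψ sends them to positive operators
  -- with sum 1. Approximation reduces the claim to one such T and a scalar c > 0, where it is
  -- positivity of T at c x - y.
  have happrox : ∀ (n : ℕ) (φ : C(I, ℝ)), Ψ (bernsteinApproximation n φ) =
      ∑ k : Fin (n + 1), φ (bernstein.z k) • Ψ (bernstein n k) := fun n φ => by
    rw [bernsteinApproximation, map_sum]
    refine Finset.sum_congr rfl fun k _ => ?_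
    rw [← map_smul]
    congr 1
    ext t
    simp [mul_comm]
  have hsum : ∀ n : ℕ, ∑ k : Fin (n + 1), Ψ (bernstein n k) = 1 := fun n => by
    rw [← map_sum, ← hone]
    congr 1
    ext t
    simp
  have hcont : ∀ (φ : C(I, ℝ)) (z : E), Tendsto
      (fun n => (⟪Ψ (bernsteinApproximation n φ) z, z⟫_ℂ).re) atTop (𝓝 (⟪Ψ φ z, z⟫_ℂ).re) :=
    fun φ z => by
      have hc : Continuous fun φ : C(I, ℝ) => (⟪Ψ φ z, z⟫_ℂ).re := by fun_prop
      exact (hc.tendsto φ).comp (bernsteinApproximation_uniform φ)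
  refine ge_of_tendsto' ((hcont f x).add (hcont g y)) fun n => ?_
  have hxy : (⟪x, y⟫_ℂ).re = ∑ k : Fin (n + 1), (⟪Ψ (bernstein n k) x, y⟫_ℂ).re := by
    conv_lhs => rw [← one_apply_eq_self (F := E →L[ℂ] E) x, ← hsum n]
    simp
  rw [happrox, happrox, hxy]
  simp only [sum_apply, sum_inner, Complex.re_sum, Finset.mul_sum,
    ← Finset.sum_add_distrib]
  refine Finset.sum_le_sum fun k _ => ?_
  have hE : 0 ≤ Ψ (bernstein n k) := hpos _ fun t => bernstein_nonneg
  set T := Ψ (bernstein n k)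
  set c := f (bernstein.z k) with hc
  have hc0 : 0 < c := hf _
  have hcg : g (bernstein.z k) = c⁻¹ := eq_inv_of_mul_eq_one_right (hfg _)
  have hTp := (ContinuousLinearMap.nonneg_iff_isPositive T).mp hE
  have h0 := hTp.re_inner_nonneg_left ((c : ℂ) • x - y)
  have hsymm : (⟪T y, x⟫_ℂ).re = (⟪T x, y⟫_ℂ).re := by
    rw [hTp.inner_left_eq_inner_right, ← inner_conj_symm, Complex.conj_re]
  have h1 : 0 ≤ c * (c * (⟪T x, x⟫_ℂ).re - (⟪T x, y⟫_ℂ).re)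
      - (c * (⟪T x, y⟫_ℂ).re - (⟪T y, y⟫_ℂ).re) := by
    simpa [inner_sub_left, inner_sub_right, inner_smul_left_eq_smul, inner_smul_right_eq_smul, hsymm,
      mul_sub] using h0
  rw [hcg]
  have h2 : (⟪(c • T) x, x⟫_ℂ).re = c * (⟪T x, x⟫_ℂ).re := by
    simp [inner_smul_left_eq_smul]
  have h3 : (⟪(c⁻¹ • T) y, y⟫_ℂ).re = c⁻¹ * (⟪T y, y⟫_ℂ).re := by
    simp [inner_smul_left_eq_smul]
  rw [h2, h3]
  have h4 : c⁻¹ * (c * (c * (⟪T x, x⟫_ℂ).re - (⟪T x, y⟫_ℂ).re)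
      - (c * (⟪T x, y⟫_ℂ).re - (⟪T y, y⟫_ℂ).re)) =
      c * (⟪T x, x⟫_ℂ).re + c⁻¹ * (⟪T y, y⟫_ℂ).re - 2 * (⟪T x, y⟫_ℂ).re := by
    field_simp; ring
  have h5 := mul_nonneg (inv_nonneg.2 hc0.le) h1
  rw [h4] at h5
  linarith

open scoped InnerProductSpace unitInterval in
/-- **Choi's inequality** `Φ(A)⁻¹ ≤ Φ(A⁻¹)` for positive unital maps. -/
theorem PositiveLinearMap.rpow_neg_one_le {H K : Type*} [NormedAddCommGroup H]
    [InnerProductSpace ℂ H] [CompleteSpace H] [NormedAddCommGroup K] [InnerProductSpace ℂ K]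
    [CompleteSpace K] (Φ : (H →L[ℂ] H) →ₚ[ℂ] (K →L[ℂ] K)) (hΦ : Φ 1 = 1) {m M : ℝ} (hm : 0 < m)
    (hM : 0 < M) {A : H →L[ℂ] H} (hmA : m • (1 : H →L[ℂ] H) ≤ A) (hAM : A ≤ M • (1 : H →L[ℂ] H)) :
    Φ A ^ (-1 : ℝ) ≤ Φ (A ^ (-1 : ℝ)) := by
  rw [← Algebra.algebraMap_eq_smul_one] at hmA hAM
  have hA : IsStrictlyPositive A := (isStrictlyPositive_algebraMap hm).of_le hmA
  have hsa : IsSelfAdjoint A := hA.isSelfAdjoint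
  have hspec₁ : ∀ t ∈ spectrum ℝ A, m ≤ t := (algebraMap_le_iff_le_spectrum hsa).mp hmA
  have hspec₂ : ∀ t ∈ spectrum ℝ A, t ≤ M := (le_algebraMap_iff_spectrum_le hsa).mp hAM
  have hΦA : IsStrictlyPositive (Φ A) := by
    refine (isStrictlyPositive_algebraMap hm).of_le (?_ : algebraMap ℝ (K →L[ℂ] K) m ≤ _)
    have := OrderHomClass.mono Φ hmA
    rwa [Algebra.algebraMap_eq_smul_one, PositiveLinearMap.map_smul_of_tower, hΦ,
      ← Algebra.algebraMap_eq_smul_one] at this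
  let e : C(spectrum ℝ A, I) := ⟨fun t => Set.projIcc 0 1 zero_le_one (t / M), by fun_prop⟩
  have he : ∀ t : spectrum ℝ A, (e t : ℝ) = t / M := fun t => by
    have h1 : (t : ℝ) / M ∈ Set.Icc (0 : ℝ) 1 :=
      ⟨div_nonneg (hm.le.trans (hspec₁ t t.2)) hM.le, (div_le_one hM).2 (hspec₂ t t.2)⟩
    simp [e, Set.projIcc_of_mem _ h1]
  let ψ : C(I, ℝ) →ₗ[ℝ] (K →L[ℂ] K) :=
    { toFun := fun g => Φ (cfcHom hsa (g.comp e))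
      map_add' := fun g g' => by
        rw [← map_add, ← map_add]; rfl
      map_smul' := fun c g => by
        rw [RingHom.id_apply, ← PositiveLinearMap.map_smul_of_tower, ← map_smul]; rfl }
  have hΦc : Continuous Φ := map_continuous Φ
  let Ψ : C(I, ℝ) →L[ℝ] (K →L[ℂ] K) :=
    ⟨ψ, hΦc.comp ((cfcHom_continuous hsa).comp (ContinuousMap.continuous_precomp e))⟩
  have hΨ : ∀ g, Ψ g = Φ (cfcHom hsa (g.comp e)) := fun _ => rfl
  -- The cutoff at m makes f invertible on all of I and leaves f ∘ e equal to the identity on the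
  -- spectrum.
  let f : C(I, ℝ) := ⟨fun t => max (M * t) m, by fun_prop⟩
  have hf : ∀ t, 0 < f t := fun t => hm.trans_le (le_max_right _ _)
  let g : C(I, ℝ) := ⟨fun t => (f t)⁻¹, f.continuous.inv₀ fun t => (hf t).ne'⟩
  have hfe : ∀ t, f (e t) = t := fun t => by
    change max (M * (e t : ℝ)) m = t
    rw [he, mul_div_cancel₀ _ hM.ne', max_eq_left (hspec₁ t t.2)]
  have hΨf : Ψ f = Φ A := by
    rw [hΨ]
    congr 1
    conv_rhs => rw [← cfcHom_id (R := ℝ) hsa]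
    congr 1
    ext t
    exact hfe t
  have hΨg : Ψ g = Φ (A ^ (-1 : ℝ)) := by
    rw [hΨ, CFC.rpow_eq_cfc_real hA.nonneg, cfc_apply (fun x : ℝ => x ^ (-1 : ℝ)) A hsa
      (fun t ht => (Real.continuousAt_rpow_const _ _
        (Or.inl (hm.trans_le (hspec₁ t ht)).ne')).continuousWithinAt)]
    congr 2
    ext t
    change (f (e t))⁻¹ = (t : ℝ) ^ (-1 : ℝ)
    rw [hfe, Real.rpow_neg_one]
  have hpos : ∀ φ : C(I, ℝ), 0 ≤ φ → 0 ≤ Ψ φ := fun φ hφ =>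
    Φ.map_nonneg ((cfcHom_nonneg_iff (R := ℝ) hsa).2 fun t => hφ (e t))
  have hone : Ψ 1 = 1 := by
    rw [hΨ, ← hΦ]
    congr 1
    exact map_one (cfcHom (R := ℝ) hsa)
  have hnn : IsSelfAdjoint (Φ (A ^ (-1 : ℝ)) - Φ A ^ (-1 : ℝ)) :=
    (Φ.map_nonneg CFC.rpow_nonneg).isSelfAdjoint.sub CFC.rpow_nonneg.isSelfAdjoint
  rw [ContinuousLinearMap.le_def, ContinuousLinearMap.isPositive_def']
  refine ⟨hnn, fun y => ?_⟩
  -- With x = Φ(A)⁻¹ y, the term ⟨Φ(A) x, x⟩ cancels half of the left side.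
  have hmain := two_re_inner_le_of_positive_unital Ψ hpos hone f g hf
    (fun t => mul_inv_cancel₀ (hf t).ne') ((Φ A ^ (-1 : ℝ)) y) y
  have hinv : Φ A ((Φ A ^ (-1 : ℝ)) y) = y := by
    have := CFC.rpow_mul_rpow_neg 1 hΦA
    rw [CFC.rpow_one _ hΦA.nonneg] at this
    exact congrArg (fun T : K →L[ℂ] K => T y) this
  rw [hΨf, hΨg, hinv] at hmain
  have hsymm : (⟪y, (Φ A ^ (-1 : ℝ)) y⟫_ℂ).re = (⟪(Φ A ^ (-1 : ℝ)) y, y⟫_ℂ).re := by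
    rw [← inner_conj_symm, Complex.conj_re]
  rw [hsymm] at hmain
  simp only [ContinuousLinearMap.reApplyInnerSelf_apply, sub_apply,
    inner_sub_left, map_sub]
  simp only [RCLike.re_to_complex]
  linarith

/-! ### Scalar bounds on real powers -/

theorem IsStrictlyPositive.smul_rpow {E : Type*} [CStarAlgebra E] [PartialOrder E]
    [StarOrderedRing E] {a : E} (ha : IsStrictlyPositive a) {c : ℝ} (hc : 0 < c) (r : ℝ) :
    (c • a) ^ r = c ^ r • a ^ r := by
  have hsp : ∀ t ∈ spectrum ℝ a, 0 < t := fun t ht => ha.spectrum_pos ht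
  have hsa : IsSelfAdjoint a := ha.isSelfAdjoint
  rw [← cfc_const_mul_id c a, CFC.cfc_rpow fun t ht => mul_pos hc (hsp t ht),
    CFC.rpow_eq_cfc_real ha.nonneg, ← cfc_smul (c ^ r) _ a fun t ht =>
      (Real.continuousAt_rpow_const _ _ (Or.inl (hsp t ht).ne')).continuousWithinAt]
  exact cfc_congr fun t ht => Real.mul_rpow hc.le (hsp t ht).le

theorem le_smul_of_inv_smul_le {E : Type*} [AddCommGroup E] [PartialOrder E] [Module ℝ E]
    [PosSMulMono ℝ E] {a b : E} {c : ℝ} (hc : 0 < c) (h : c⁻¹ • a ≤ b) : a ≤ c • b := by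
  have := smul_le_smul_of_nonneg_left h hc.le
  rwa [smul_inv_smul₀ hc.ne'] at this

/-- Bounding a power linearly in `a` lets two noncommuting powers be added. -/
theorem rpow_le_rpow_sub_one_smul {E : Type*} [CStarAlgebra E] [PartialOrder E]
    [StarOrderedRing E] {a : E} (ha : IsStrictlyPositive a) {s : ℝ}
    (has : a ≤ s • (1 : E)) {r : ℝ} (hr : 1 ≤ r) :
    a ^ r ≤ s ^ (r - 1) • a := by
  have hsp : ∀ t ∈ spectrum ℝ a, 0 < t := fun t ht => ha.spectrum_pos ht
  have hsa : IsSelfAdjoint a := ha.isSelfAdjoint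
  rw [← Algebra.algebraMap_eq_smul_one] at has
  have hle := (le_algebraMap_iff_spectrum_le hsa).mp has
  rw [CFC.rpow_eq_cfc_real ha.nonneg, ← cfc_const_mul_id (s ^ (r - 1)) a]
  refine cfc_mono (fun t ht => ?_) (fun t ht =>
      (Real.continuousAt_rpow_const _ _ (Or.inl (hsp t ht).ne')).continuousWithinAt)
  have h0 := hsp t ht
  calc t ^ r = t ^ (r - 1) * t := by rw [Real.rpow_sub_one h0.ne']; field_simp
    _ ≤ s ^ (r - 1) * t := by
        gcongr
        exact hle t ht

/-- The Ando–Zhan inequality `‖a ^ r + b ^ r‖ ≤ ‖a + b‖ ^ r`, `r ≥ 1`, in order form. -/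
theorem rpow_add_rpow_le {E : Type*} [CStarAlgebra E] [PartialOrder E] [StarOrderedRing E]
    {a b : E} (ha : IsStrictlyPositive a) (hb : IsStrictlyPositive b) {s : ℝ} (hs : 0 < s)
    (h : a + b ≤ s • (1 : E)) {r : ℝ} (hr : 1 ≤ r) :
    a ^ r + b ^ r ≤ s ^ r • (1 : E) := by
  have h1 := rpow_le_rpow_sub_one_smul ha
    ((le_add_of_nonneg_right hb.nonneg).trans h) hr
  have h2 := rpow_le_rpow_sub_one_smul hb
    ((le_add_of_nonneg_left ha.nonneg).trans h) hr
  calc a ^ r + b ^ r ≤ s ^ (r - 1) • a + s ^ (r - 1) • b := add_le_add h1 h2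
    _ = s ^ (r - 1) • (a + b) := (smul_add _ _ _).symm
    _ ≤ s ^ (r - 1) • s • (1 : E) := smul_le_smul_of_nonneg_left h (by positivity)
    _ = s ^ r • (1 : E) := by
        rw [smul_smul, Real.rpow_sub_one hs.ne']
        congr 1
        field_simp

/-- If `m ≤ X ≤ M`, then `X ^ α + (M m) ^ α X ^ (-α) ≤ M ^ α + m ^ α`. -/
theorem rpow_add_smul_rpow_neg_le {E : Type*} [CStarAlgebra E] [PartialOrder E]
    [StarOrderedRing E] {X : E} {m M : ℝ} (hm : 0 < m) (hM : 0 < M) (hmX : m • (1 : E) ≤ X)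
    (hXM : X ≤ M • (1 : E)) {α : ℝ} (hα : 0 ≤ α) :
    X ^ α + (M * m) ^ α • X ^ (-α) ≤ (M ^ α + m ^ α) • (1 : E) := by
  rw [← Algebra.algebraMap_eq_smul_one] at hmX hXM
  have hX : IsStrictlyPositive X := (isStrictlyPositive_algebraMap hm).of_le hmX
  have hsa : IsSelfAdjoint X := hX.isSelfAdjoint
  have h₁ := (algebraMap_le_iff_le_spectrum hsa).mp hmX
  have h₂ := (le_algebraMap_iff_spectrum_le hsa).mp hXM
  have hc : ∀ r : ℝ, ContinuousOn (fun t : ℝ => t ^ r) (spectrum ℝ X) := fun r t ht =>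
    (Real.continuousAt_rpow_const _ _ (Or.inl (hm.trans_le (h₁ t ht)).ne')).continuousWithinAt
  rw [CFC.rpow_eq_cfc_real hX.nonneg, CFC.rpow_eq_cfc_real hX.nonneg, ← cfc_smul _ _ X (hc _),
    ← cfc_add (a := X) (fun t : ℝ => t ^ α) (fun t : ℝ => (M * m) ^ α • t ^ (-α)) (hc _)
      (continuousOn_const.mul (hc (-α))), ← Algebra.algebraMap_eq_smul_one]
  refine cfc_le_algebraMap _ _ X (fun t ht => ?_) ((hc α).add (continuousOn_const.mul (hc (-α))))
  have ht0 : 0 < t := hm.trans_le (h₁ t ht)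
  have hma : m ^ α ≤ t ^ α := Real.rpow_le_rpow hm.le (h₁ t ht) hα
  have hMa : t ^ α ≤ M ^ α := Real.rpow_le_rpow ht0.le (h₂ t ht) hα
  have hta : 0 < t ^ α := Real.rpow_pos_of_pos ht0 _
  rw [smul_eq_mul, Real.mul_rpow hM.le hm.le, Real.rpow_neg ht0.le]
  -- The gap factors into nonnegative terms because t lies in [m, M].
  have : M ^ α + m ^ α - (t ^ α + M ^ α * m ^ α * (t ^ α)⁻¹) =
      (M ^ α - t ^ α) * (t ^ α - m ^ α) * (t ^ α)⁻¹ := by field_simp; ring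
  have h3 := mul_nonneg (mul_nonneg (sub_nonneg.2 hMa) (sub_nonneg.2 hma)) (inv_nonneg.2 hta.le)
  linarith

/-! ### From a bound on a sum to a comparison of powers -/

/-- If `P + a Q⁻¹ ≤ s` for strictly positive `P`, `Q`, then `P² ≤ (s² / (4 a))² Q²`. -/
theorem rpow_two_le_of_add_smul_inv_le {E : Type*} [NormedAddCommGroup E]
    [InnerProductSpace ℂ E] [CompleteSpace E] {P Q : E →L[ℂ] E} (hP : 0 ≤ P)
    (hQ : IsStrictlyPositive Q) {a s : ℝ} (ha : 0 < a)
    (h : P + a • Q ^ (-1 : ℝ) ≤ s • (1 : E →L[ℂ] E)) :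
    P ^ (2 : ℝ) ≤ (s ^ 2 / (4 * a)) ^ 2 • Q ^ (2 : ℝ) := by
  have hsq : ∀ T : E →L[ℂ] E, 0 ≤ T → T ^ (2 : ℝ) = T * T := fun T hT => by
    have := CFC.rpow_natCast T 2 hT
    rw [← pow_two, ← this]; norm_num
  rw [hsq P hP, hsq Q hQ.nonneg, ContinuousLinearMap.le_def,
    ContinuousLinearMap.isPositive_def']
  have hPs : IsSelfAdjoint P := hP.isSelfAdjoint
  have hQs : IsSelfAdjoint Q := hQ.isSelfAdjoint
  have hinner : ∀ T : E →L[ℂ] E, IsSelfAdjoint T → ∀ y : E,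
      (inner ℂ (T (T y)) y).re = ‖T y‖ ^ 2 := fun T hT y => by
    have h1 : inner ℂ (T (T y)) y = inner ℂ (T y) (T y) := hT.isSymmetric (T y) y
    rw [h1, inner_self_eq_norm_sq_to_K]
    norm_cast
  have hPP : IsSelfAdjoint (P * P) := by simpa [pow_two] using hPs.pow 2
  have hQQ : IsSelfAdjoint (Q * Q) := by simpa [pow_two] using hQs.pow 2
  refine ⟨(IsSelfAdjoint.smul (IsSelfAdjoint.all ((s ^ 2 / (4 * a)) ^ 2)) hQQ).sub hPP,
    fun y => ?_⟩
  -- At the vector Q y the factor Q⁻¹ disappears, leaving a bound on a ‖P y‖.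
  have hb := norm_apply_apply_le hP (smul_nonneg ha.le CFC.rpow_nonneg) h (Q y)
  have hinv : (Q ^ (-1 : ℝ)) (Q y) = y := by
    have := CFC.rpow_neg_mul_rpow 1 hQ
    rw [CFC.rpow_one _ hQ.nonneg] at this
    exact congrArg (fun T : E →L[ℂ] E => T y) this
  have hb' : ‖P y‖ ≤ s ^ 2 / (4 * a) * ‖Q y‖ := by
    have e : P ((a • Q ^ (-1 : ℝ)) (Q y)) = a • P y := by
      rw [smul_apply, hinv, ContinuousLinearMap.map_smul_of_tower]
    rw [e, norm_smul, Real.norm_of_nonneg ha.le] at hb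
    rw [← mul_le_mul_iff_right₀ ha]
    calc _ ≤ _ := hb
      _ = _ := by field_simp
  have hb2 := pow_le_pow_left₀ (norm_nonneg _) hb' 2
  rw [mul_pow] at hb2
  have e1 : ∀ c : ℝ, ContinuousLinearMap.reApplyInnerSelf (c • (Q * Q) - P * P) y =
      c * ‖Q y‖ ^ 2 - ‖P y‖ ^ 2 := fun c => by
    rw [ContinuousLinearMap.reApplyInnerSelf_apply]
    simp [inner_sub_left, inner_smul_left_eq_smul, hinner P hPs, hinner Q hQs]
  rw [e1]
  linarith

/-- The core estimate: `X + M m Y⁻¹ ≤ M + m` and `m ≤ X ≤ M` imply `X ^ p ≤ c Y ^ p`. -/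
theorem rpow_le_meanBound_smul_rpow {E : Type*} [NormedAddCommGroup E]
    [InnerProductSpace ℂ E] [CompleteSpace E] {X Y : E →L[ℂ] E} {m M α p : ℝ} (hm : 0 < m)
    (hM : 0 < M) (hmX : m • (1 : E →L[ℂ] E) ≤ X) (hXM : X ≤ M • (1 : E →L[ℂ] E))
    (hY : IsStrictlyPositive Y) (hXY : X + (M * m) • Y ^ (-1 : ℝ) ≤ (M + m) • (1 : E →L[ℂ] E))
    (hα : 0 < α) (hα2 : α ≤ 2) (hp : 2 * α ≤ p) :
    X ^ p ≤ meanBound m M α p • Y ^ p := by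
  have hX : IsStrictlyPositive X := by
    rw [← Algebra.algebraMap_eq_smul_one] at hmX
    exact (isStrictlyPositive_algebraMap hm).of_le hmX
  have hMm : 0 < M * m := mul_pos hM hm
  have hp0 : 0 < p := by linarith
  set k := kantorovich (M / m) with hk
  have hk' : k = (M + m) ^ 2 / (4 * (M * m)) := by
    rw [hk, kantorovich]; field_simp
  have hk0 : 0 < k := by rw [hk']; positivity
  have h2 : X ^ (2 : ℝ) ≤ k ^ 2 • Y ^ (2 : ℝ) := by
    rw [hk']; exact rpow_two_le_of_add_smul_inv_le hX.nonneg hY hMm hXY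
  have hα' : X ^ α ≤ k ^ α • Y ^ α := by
    -- Löwner–Heinz needs the exponent α / 2 to be at most 1.
    have := CFC.rpow_le_rpow (p := α / 2) ⟨by positivity, by linarith⟩ h2
    rw [(IsStrictlyPositive.rpow Y 2 hY).smul_rpow (by positivity), CFC.rpow_rpow X _ _ two_ne_zero,
      CFC.rpow_rpow Y _ _ two_ne_zero, mul_div_cancel₀ _ (two_ne_zero' ℝ), ← Real.rpow_natCast,
      ← Real.rpow_mul hk0.le] at this
    simpa [mul_div_cancel₀] using this
  have hneg : Y ^ (-α) ≤ k ^ α • X ^ (-α) := by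
    have := CStarAlgebra.rpow_neg_one_le_rpow_neg_one hα'
    rw [(IsStrictlyPositive.rpow Y α hY).smul_rpow (by positivity), CFC.rpow_rpow X _ _ hα.ne',
      CFC.rpow_rpow Y _ _ hα.ne', Real.rpow_neg_one, mul_neg_one] at this
    exact le_smul_of_inv_smul_le (by positivity) this
  set s := k ^ (α / 2) * (M ^ α + m ^ α) with hs
  have hs0 : 0 < s := by positivity
  -- The weights k^(±α/2) balance the sum: once Y^(-α) is replaced by k^α X^(-α), both terms carry
  -- k^(α/2).
  have hsum : k ^ (α / 2) • X ^ α + (k ^ (-(α / 2)) * (M * m) ^ α) • Y ^ (-α) ≤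
      s • (1 : E →L[ℂ] E) := by
    calc _ ≤ k ^ (α / 2) • X ^ α + (k ^ (-(α / 2)) * (M * m) ^ α) • k ^ α • X ^ (-α) := by
          gcongr
      _ = k ^ (α / 2) • (X ^ α + (M * m) ^ α • X ^ (-α)) := by
          rw [smul_add, smul_smul, smul_smul]
          congr 2
          rw [mul_right_comm, ← Real.rpow_add hk0]
          congr 2
          ring
      _ ≤ k ^ (α / 2) • (M ^ α + m ^ α) • (1 : E →L[ℂ] E) := by
          gcongr
          exact rpow_add_smul_rpow_neg_le hm hM hmX hXM hα.le
      _ = s • (1 : E →L[ℂ] E) := by rw [smul_smul]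
  have hr : 1 ≤ p / (2 * α) := (one_le_div (by positivity)).2 hp
  have hXα : IsStrictlyPositive (X ^ α) := IsStrictlyPositive.rpow X α hX
  have hYα : IsStrictlyPositive (Y ^ (-α)) := IsStrictlyPositive.rpow Y (-α) hY
  have hpow := rpow_add_rpow_le (IsStrictlyPositive.smul (c := k ^ (α / 2)) (by positivity) hXα)
    (IsStrictlyPositive.smul (c := k ^ (-(α / 2)) * (M * m) ^ α) (by positivity) hYα)
    hs0 hsum hr
  rw [hXα.smul_rpow (by positivity), hYα.smul_rpow (by positivity), CFC.rpow_rpow X _ _ hα.ne',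
    CFC.rpow_rpow Y _ _ (neg_ne_zero.2 hα.ne'), Real.mul_rpow (by positivity) (by positivity),
    ← Real.rpow_mul hk0.le, ← Real.rpow_mul hk0.le, ← Real.rpow_mul hMm.le] at hpow
  rw [show α * (p / (2 * α)) = p / 2 by field_simp, show -α * (p / (2 * α)) = p / 2 * -1 by
    field_simp, ← CFC.rpow_rpow Y _ _ (by positivity),
    show α / 2 * (p / (2 * α)) = p / 4 by field_simp; norm_num,
    show -(α / 2) * (p / (2 * α)) = -(p / 4) by field_simp; norm_num] at hpow
  have hXp : IsStrictlyPositive (X ^ (p / 2)) := IsStrictlyPositive.rpow X _ hX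
  have hYp : IsStrictlyPositive (Y ^ (p / 2)) := IsStrictlyPositive.rpow Y _ hY
  -- Squaring k^(p/4) X^(p/2) gives a factor k^(p/2) on the left; the weight k^(-(p/4)) of the
  -- inverse term gives the same factor on the right, so they cancel.
  have hfin := rpow_two_le_of_add_smul_inv_le
    (IsStrictlyPositive.smul (c := k ^ (p / 4)) (by positivity) hXp).nonneg hYp
    (by positivity) hpow
  rw [hXp.smul_rpow (by positivity), CFC.rpow_rpow X _ _ (by positivity),
    CFC.rpow_rpow Y _ _ (by positivity), div_mul_cancel₀ _ (two_ne_zero' ℝ)] at hfin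
  have hfin' := le_smul_of_inv_smul_le (c := ((k ^ (p / 4)) ^ (2 : ℝ))⁻¹) (by positivity)
    (by rwa [inv_inv])
  rw [smul_smul] at hfin'
  convert hfin' using 2
  rw [meanBound, ← hk, ← hs,
    show 2 * p / α = p / (2 * α) * (4 : ℕ) by push_cast; field_simp; norm_num,
    Real.rpow_mul hs0.le, Real.rpow_natCast, Real.rpow_neg hk0.le, mul_assoc 16,
    ← Real.mul_rpow hM.le hm.le, show (M * m) ^ p = ((M * m) ^ (p / 2)) ^ 2 by
      rw [← Real.rpow_natCast, ← Real.rpow_mul hMm.le]; congr 1; push_cast; ring, Real.rpow_two]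
  have := Real.rpow_pos_of_pos hMm (p / 2)
  have := Real.rpow_pos_of_pos hk0 (p / 4)
  field_simp
  norm_num

/-! ### Inverses and bounds for means -/

theorem rpow_neg_one_le_inv_smul {E : Type*} [CStarAlgebra E] [PartialOrder E]
    [StarOrderedRing E] {a : E} {m : ℝ} (hm : 0 < m) (h : m • (1 : E) ≤ a) :
    a ^ (-1 : ℝ) ≤ m⁻¹ • (1 : E) := by
  have h1 : IsStrictlyPositive (m • (1 : E)) := isStrictlyPositive_one.smul hm
  have := CStarAlgebra.rpow_neg_one_le_rpow_neg_one h
  rwa [isStrictlyPositive_one.smul_rpow hm, CFC.one_rpow, Real.rpow_neg_one] at this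

theorem le_of_rpow_neg_one_le {E : Type*} [CStarAlgebra E] [PartialOrder E]
    [StarOrderedRing E] {a b : E} (ha : IsStrictlyPositive a) (hb : IsStrictlyPositive b)
    (h : a ^ (-1 : ℝ) ≤ b ^ (-1 : ℝ)) : b ≤ a := by
  have h1 : IsStrictlyPositive (a ^ (-1 : ℝ)) := IsStrictlyPositive.rpow a _ ha
  have := CStarAlgebra.rpow_neg_one_le_rpow_neg_one h
  simpa [CFC.rpow_rpow a (-1) (-1) (by norm_num), CFC.rpow_rpow b (-1) (-1) (by norm_num),
    CFC.rpow_one a ha.nonneg, CFC.rpow_one b hb.nonneg] using this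

section Means

variable {E : Type*} [NormedAddCommGroup E] [InnerProductSpace ℂ E] [CompleteSpace E]
  {A B : E →L[ℂ] E}

theorem isStrictlyPositive_of_smul_one_le {m : ℝ} (hm : 0 < m) (h : m • (1 : E →L[ℂ] E) ≤ A) :
    IsStrictlyPositive A :=
  (isStrictlyPositive_one.smul hm).of_le h

theorem harmonicMean_eq_rpow (hA : IsStrictlyPositive A) (hB : IsStrictlyPositive B) :
    harmonicMean A B =
      ((1 / 2 : ℝ) • A ^ (-1 : ℝ) + (1 / 2 : ℝ) • B ^ (-1 : ℝ)) ^ (-1 : ℝ) := by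
  have h1 : IsStrictlyPositive (A ^ (-1 : ℝ)) := IsStrictlyPositive.rpow A _ hA
  have h2 : IsStrictlyPositive (B ^ (-1 : ℝ)) := IsStrictlyPositive.rpow B _ hB
  rw [harmonicMean, CFC.inverse_eq_rpow_neg_one hA, CFC.inverse_eq_rpow_neg_one hB,
    CFC.inverse_eq_rpow_neg_one
      ((h1.smul (by norm_num)).add_nonneg (h2.smul (by norm_num)).nonneg)]

/-- Inversion reverses the order and makes the harmonic bound linear in A⁻¹ and B⁻¹, so a linear map
can be applied to it. -/
theorem IsBetweenHarmonicArithmetic.rpow_neg_one_le {σ : (E →L[ℂ] E) → (E →L[ℂ] E) → (E →L[ℂ] E)}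
    (hσ : IsBetweenHarmonicArithmetic σ) (hA : IsStrictlyPositive A) (hB : IsStrictlyPositive B) :
    σ A B ^ (-1 : ℝ) ≤ (1 / 2 : ℝ) • A ^ (-1 : ℝ) + (1 / 2 : ℝ) • B ^ (-1 : ℝ) := by
  have h1 : IsStrictlyPositive (A ^ (-1 : ℝ)) := IsStrictlyPositive.rpow A _ hA
  have h2 : IsStrictlyPositive (B ^ (-1 : ℝ)) := IsStrictlyPositive.rpow B _ hB
  have h3 : IsStrictlyPositive ((1 / 2 : ℝ) • A ^ (-1 : ℝ) + (1 / 2 : ℝ) • B ^ (-1 : ℝ)) :=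
    (h1.smul (by norm_num)).add_nonneg (h2.smul (by norm_num)).nonneg
  have h4 : IsStrictlyPositive
      (((1 / 2 : ℝ) • A ^ (-1 : ℝ) + (1 / 2 : ℝ) • B ^ (-1 : ℝ)) ^ (-1 : ℝ)) :=
    IsStrictlyPositive.rpow _ _ h3
  have h5 := (hσ A B hA hB).1
  rw [harmonicMean_eq_rpow hA hB] at h5
  have h6 := CStarAlgebra.rpow_neg_one_le_rpow_neg_one h5
  rwa [CFC.rpow_rpow _ (-1) (-1) (by norm_num), show (-1 : ℝ) * -1 = 1 by norm_num,
    CFC.rpow_one _ h3.nonneg] at h6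

theorem arithmeticMean_mono {C D : E →L[ℂ] E} (h₁ : A ≤ C) (h₂ : B ≤ D) :
    arithmeticMean A B ≤ arithmeticMean C D :=
  add_le_add (smul_le_smul_of_nonneg_left h₁ (by norm_num))
    (smul_le_smul_of_nonneg_left h₂ (by norm_num))

theorem arithmeticMean_self (A : E →L[ℂ] E) : arithmeticMean A A = A := by
  rw [arithmeticMean, ← add_smul]; norm_num

theorem IsBetweenHarmonicArithmetic.le_smul_one {σ : (E →L[ℂ] E) → (E →L[ℂ] E) → (E →L[ℂ] E)}
    (hσ : IsBetweenHarmonicArithmetic σ) (hA : IsStrictlyPositive A) (hB : IsStrictlyPositive B)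
    {M : ℝ} (hAM : A ≤ M • (1 : E →L[ℂ] E)) (hBM : B ≤ M • (1 : E →L[ℂ] E)) :
    σ A B ≤ M • (1 : E →L[ℂ] E) :=
  ((hσ A B hA hB).2.trans (arithmeticMean_mono hAM hBM)).trans (arithmeticMean_self _).le

/-- After inversion this is the upper bound m⁻¹ for an average of inverses. -/
theorem IsBetweenHarmonicArithmetic.smul_one_le {σ : (E →L[ℂ] E) → (E →L[ℂ] E) → (E →L[ℂ] E)}
    (hσ : IsBetweenHarmonicArithmetic σ) (hσ' : IsOperatorMean σ) {m : ℝ} (hm : 0 < m)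
    (hmA : m • (1 : E →L[ℂ] E) ≤ A) (hmB : m • (1 : E →L[ℂ] E) ≤ B) :
    m • (1 : E →L[ℂ] E) ≤ σ A B := by
  have hA := isStrictlyPositive_of_smul_one_le hm hmA
  have hB := isStrictlyPositive_of_smul_one_le hm hmB
  refine le_of_rpow_neg_one_le (hσ'.isStrictlyPositive A B hA hB)
    (isStrictlyPositive_one.smul hm) ?_
  rw [isStrictlyPositive_one.smul_rpow hm, CFC.one_rpow, Real.rpow_neg_one]
  exact ((hσ.rpow_neg_one_le hA hB).trans (arithmeticMean_mono (rpow_neg_one_le_inv_smul hm hmA)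
    (rpow_neg_one_le_inv_smul hm hmB))).trans (arithmeticMean_self _).le

end Means

/-! ### Unital positive maps and the main theorem -/

theorem PositiveLinearMap.map_arithmeticMean {H K : Type*} [NormedAddCommGroup H]
    [InnerProductSpace ℂ H] [CompleteSpace H] [NormedAddCommGroup K] [InnerProductSpace ℂ K]
    [CompleteSpace K] (Φ : (H →L[ℂ] H) →ₚ[ℂ] (K →L[ℂ] K)) (A B : H →L[ℂ] H) :
    Φ (arithmeticMean A B) = arithmeticMean (Φ A) (Φ B) := by
  rw [arithmeticMean, arithmeticMean, map_add, PositiveLinearMap.map_smul_of_tower,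
    PositiveLinearMap.map_smul_of_tower]

theorem PositiveLinearMap.map_smul_one {H K : Type*} [NormedAddCommGroup H]
    [InnerProductSpace ℂ H] [CompleteSpace H] [NormedAddCommGroup K] [InnerProductSpace ℂ K]
    [CompleteSpace K] (Φ : (H →L[ℂ] H) →ₚ[ℂ] (K →L[ℂ] K)) (hΦ : Φ 1 = 1) (r : ℝ) :
    Φ (r • (1 : H →L[ℂ] H)) = r • (1 : K →L[ℂ] K) := by
  rw [PositiveLinearMap.map_smul_of_tower, hΦ]

/-- The operations `σH`, `τH` are the means `σ`, `τ` on `B(H)`, and `σK`, `τK` are the means `σ`,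
`τ` on `B(K)`. -/
theorem theorem2p10
    {H : Type*} [NormedAddCommGroup H] [InnerProductSpace ℂ H] [CompleteSpace H]
    {K : Type*} [NormedAddCommGroup K] [InnerProductSpace ℂ K] [CompleteSpace K]
    (σH τH : (H →L[ℂ] H) → (H →L[ℂ] H) → (H →L[ℂ] H))
    (σK τK : (K →L[ℂ] K) → (K →L[ℂ] K) → (K →L[ℂ] K))
    (hσH : IsOperatorMean σH) (hτH : IsOperatorMean τH)
    (hσK : IsOperatorMean σK) (hτK : IsOperatorMean τK)
    (hσH' : IsBetweenHarmonicArithmetic σH) (hτH' : IsBetweenHarmonicArithmetic τH)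
    (hσK' : IsBetweenHarmonicArithmetic σK) (hτK' : IsBetweenHarmonicArithmetic τK)
    (m M : ℝ) (hm : 0 < m) (A B : H →L[ℂ] H)
    (hmA : m • (1 : H →L[ℂ] H) ≤ A) (hAM : A ≤ M • (1 : H →L[ℂ] H))
    (hmB : m • (1 : H →L[ℂ] H) ≤ B) (hBM : B ≤ M • (1 : H →L[ℂ] H))
    (α p : ℝ) (hα : 1 < α) (hα2 : α ≤ 2) (hp : 2 * α ≤ p)
    (Φ : (H →L[ℂ] H) →ₚ[ℂ] (K →L[ℂ] K)) (hΦ : Φ 1 = 1) :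
    Φ (σH A B) ^ p ≤ meanBound m M α p • Φ (τH A B) ^ p ∧
    Φ (σH A B) ^ p ≤ meanBound m M α p • τK (Φ A) (Φ B) ^ p ∧
    σK (Φ A) (Φ B) ^ p ≤ meanBound m M α p • Φ (τH A B) ^ p ∧
    σK (Φ A) (Φ B) ^ p ≤ meanBound m M α p • τK (Φ A) (Φ B) ^ p := by

  -- Only for nontrivial H do the bounds on A force m ≤ M; otherwise unitality gives 1 = 0 on K.
  rcases subsingleton_or_nontrivial H with hH | hH
  · have h01 : (1 : K →L[ℂ] K) = 0 := by
      rw [← hΦ, Subsingleton.elim (1 : H →L[ℂ] H) 0, map_zero]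
    have : Subsingleton (K →L[ℂ] K) := subsingleton_of_zero_eq_one h01.symm
    exact ⟨(Subsingleton.elim _ _).le, (Subsingleton.elim _ _).le, (Subsingleton.elim _ _).le,
      (Subsingleton.elim _ _).le⟩
  have hM : 0 < M := by
    obtain ⟨x, hx⟩ := exists_ne (0 : H)
    have h := re_inner_le_of_le (hmA.trans hAM) x
    have e : ∀ r : ℝ, (inner ℂ ((r • (1 : H →L[ℂ] H)) x) x).re = r * ‖x‖ ^ 2 := fun r => by
      have h1 : (inner ℂ x x).re = ‖x‖ ^ 2 := by
        rw [inner_self_eq_norm_sq_to_K]; norm_cast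
      rw [smul_apply, one_apply_eq_self, inner_smul_left_eq_smul, Complex.smul_re, h1, smul_eq_mul]
    rw [e, e] at h
    exact hm.trans_le (le_of_mul_le_mul_right h (by positivity))
  have hA := isStrictlyPositive_of_smul_one_le hm hmA
  have hB := isStrictlyPositive_of_smul_one_le hm hmB
  have hlow : ∀ T : H →L[ℂ] H, m • (1 : H →L[ℂ] H) ≤ T → m • (1 : K →L[ℂ] K) ≤ Φ T :=
    fun T h => (Φ.map_smul_one hΦ m).ge.trans (OrderHomClass.mono Φ h)
  have hupp : ∀ T : H →L[ℂ] H, T ≤ M • (1 : H →L[ℂ] H) → Φ T ≤ M • (1 : K →L[ℂ] K) :=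
    fun T h => (OrderHomClass.mono Φ h).trans (Φ.map_smul_one hΦ M).le
  have hΦA := isStrictlyPositive_of_smul_one_le hm (hlow A hmA)
  have hΦB := isStrictlyPositive_of_smul_one_le hm (hlow B hmB)
  have hlin : ∀ T : H →L[ℂ] H, m • (1 : H →L[ℂ] H) ≤ T → T ≤ M • (1 : H →L[ℂ] H) →
      Φ T + (M * m) • Φ (T ^ (-1 : ℝ)) ≤ (M + m) • (1 : K →L[ℂ] K) := fun T h₁ h₂ => by
    have hT := (isStrictlyPositive_of_smul_one_le hm h₁).nonneg
    have h := rpow_add_smul_rpow_neg_le hm hM h₁ h₂ zero_le_one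
    rw [CFC.rpow_one T hT, Real.rpow_one, Real.rpow_one, Real.rpow_one] at h
    have h' := OrderHomClass.mono Φ h
    rwa [map_add, PositiveLinearMap.map_smul_of_tower, Φ.map_smul_one hΦ] at h'
  -- Both choices of X and both choices of Y satisfy these conditions, which yields all four
  -- inequalities.
  have core : ∀ X Y : K →L[ℂ] K, m • (1 : K →L[ℂ] K) ≤ X → X ≤ M • (1 : K →L[ℂ] K) →
      X ≤ arithmeticMean (Φ A) (Φ B) → IsStrictlyPositive Y →
      Y ^ (-1 : ℝ) ≤ arithmeticMean (Φ (A ^ (-1 : ℝ))) (Φ (B ^ (-1 : ℝ))) →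
      X ^ p ≤ meanBound m M α p • Y ^ p := fun X Y h₁ h₂ h₃ h₄ h₅ => by
    refine rpow_le_meanBound_smul_rpow hm hM h₁ h₂ h₄ ?_ (by linarith) hα2 hp
    have hMm : 0 ≤ M * m := by positivity
    calc X + (M * m) • Y ^ (-1 : ℝ)
        ≤ arithmeticMean (Φ A) (Φ B) +
          (M * m) • arithmeticMean (Φ (A ^ (-1 : ℝ))) (Φ (B ^ (-1 : ℝ))) :=
          add_le_add h₃ (smul_le_smul_of_nonneg_left h₅ hMm)
      _ = arithmeticMean (Φ A + (M * m) • Φ (A ^ (-1 : ℝ)))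
          (Φ B + (M * m) • Φ (B ^ (-1 : ℝ))) := by
          simp only [arithmeticMean]; module
      _ ≤ (M + m) • (1 : K →L[ℂ] K) :=
          (arithmeticMean_mono (hlin A hmA hAM) (hlin B hmB hBM)).trans (arithmeticMean_self _).le
  have hX₁ : Φ (σH A B) ≤ arithmeticMean (Φ A) (Φ B) :=
    (OrderHomClass.mono Φ (hσH' A B hA hB).2).trans (Φ.map_arithmeticMean A B).le
  have hX₂ : σK (Φ A) (Φ B) ≤ arithmeticMean (Φ A) (Φ B) := (hσK' _ _ hΦA hΦB).2
  have hmτ := hτH'.smul_one_le hτH hm hmA hmB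
  have hτM := hτH'.le_smul_one hA hB hAM hBM
  have hY₁ : Φ (τH A B) ^ (-1 : ℝ) ≤ arithmeticMean (Φ (A ^ (-1 : ℝ))) (Φ (B ^ (-1 : ℝ))) :=
    ((Φ.rpow_neg_one_le hΦ hm hM hmτ hτM).trans
      (OrderHomClass.mono Φ (hτH'.rpow_neg_one_le hA hB))).trans (Φ.map_arithmeticMean _ _).le
  have hY₂ : τK (Φ A) (Φ B) ^ (-1 : ℝ) ≤ arithmeticMean (Φ (A ^ (-1 : ℝ))) (Φ (B ^ (-1 : ℝ))) :=
    (hτK'.rpow_neg_one_le hΦA hΦB).trans (arithmeticMean_mono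
      (Φ.rpow_neg_one_le hΦ hm hM hmA hAM) (Φ.rpow_neg_one_le hΦ hm hM hmB hBM))
  have hX₁m := hlow _ (hσH'.smul_one_le hσH hm hmA hmB)
  have hX₁M := hupp _ (hσH'.le_smul_one hA hB hAM hBM)
  have hX₂m := hσK'.smul_one_le hσK hm (hlow A hmA) (hlow B hmB)
  have hX₂M := hσK'.le_smul_one hΦA hΦB (hupp A hAM) (hupp B hBM)
  have hY₁p := isStrictlyPositive_of_smul_one_le hm (hlow _ hmτ)
  have hY₂p := hτK.isStrictlyPositive _ _ hΦA hΦB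
  exact ⟨core _ _ hX₁m hX₁M hX₁ hY₁p hY₁, core _ _ hX₁m hX₁M hX₁ hY₂p hY₂,
    core _ _ hX₂m hX₂M hX₂ hY₁p hY₁, core _ _ hX₂m hX₂M hX₂ hY₂p hY₂⟩
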